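/- Let $w = w_1w_2w_3\cdots$ be an infinite binary word, i.e. a sequence of letters $w_i\in\{0,1\}$. A factor of $w$ is a finite block $w_{i+1}\cdots w_{i+n}$ of consecutive letters. For $a\in\{0,1\}$ and $n\ge 0$ let $F^a_w(n)$ be the maximum number of letters $a$ in a factor of $w$ of length $n$. The prefix normal forms of $w$ are the infinite binary words $\mathrm{PNF}_1(w)$ and $\mathrm{PNF}_0(w)$ whose $n$-th letters ($n\ge 1$) are $F^1_w(n)-F^1_w(n-1)$ and $1-\bigl(F^0_w(n)-F^0_w(n-1)\bigr)$, respectively. Let $\max(w)$ (resp. $\min(w)$) be the infinite binary word whose prefix of length $n$ is, for every $n$, the lexicographically greatest (resp. smallest) factor of $w$ of length $n$, where $0<1$. Call $w$ characteristic Sturmian if it is the characteristic word of slope $\alpha$ for some irrational $\alpha\in[0,1]$, that is, if for some such $\alpha$ the word $0w$ (the letter $0$ followed by $w$) is the lower mechanical word with $n$-th letter $\lfloor\alpha n\rfloor-\lfloor\alpha(n-1)\rfloor$ and $1w$ is the upper mechanical word with $n$-th letter $\lceil\alpha n\rceil-\lceil\alpha(n-1)\rceil$, for all $n\ge1$. Then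 $w$ is characteristic Sturmian if and only if $$0w=\mathrm{PNF}_0(w)=\min(w)\quad\text{and}\quad 1w=\mathrm{PNF}_1(w)=\max(w).$$ -/

import Mathlib

namespace BinaryWord

/-- Infinite binary words over the ordered alphabet `{0 < 1}`. The letter `w_i` of the usual
notation `w = w_1 w_2 w_3 ⋯` is `w (i - 1)`: positions start at `0` here. -/
abbrev InfWord : Type := ℕ → Fin 2

/-- The infinite word `a w`: the letter `a` followed by `w`. -/
def cons (a : Fin 2) (w : InfWord) : InfWord
  | 0 => a
  | n + 1 => w n

/-- The block of length `n` of `w` that starts at position `i`. -/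
def block (w : InfWord) (i n : ℕ) : List (Fin 2) :=
  List.ofFn fun j : Fin n => w (i + j)

/-- The prefix of length `n` of `w`. -/
def pref (w : InfWord) (n : ℕ) : List (Fin 2) := block w 0 n

/-- The set of factors of length `n` of `w`. -/
def factors (w : InfWord) (n : ℕ) : Set (List (Fin 2)) :=
  {u | ∃ i, u = block w i n}

/-- `maxCount a w n` is the maximum number of letters `a` in a factor of length `n` of `w`
(see `maxCount_isGreatest`: the maximum exists). -/
noncomputable def maxCount (a : Fin 2) (w : InfWord) (n : ℕ) : ℕ :=
  sSup {k | ∃ u ∈ factors w n, k = u.count a}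

theorem length_block (w : InfWord) (i n : ℕ) : (block w i n).length = n := by
  simp [block]

theorem block_succ (w : InfWord) (i n : ℕ) :
    block w i (n + 1) = block w i n ++ [w (i + n)] := by
  rw [block, List.ofFn_succ', List.concat_eq_append]
  rfl

theorem factors_nonempty (w : InfWord) (n : ℕ) : (factors w n).Nonempty :=
  ⟨block w 0 n, 0, rfl⟩

theorem factors_finite (w : InfWord) (n : ℕ) : (factors w n).Finite := by
  refine (List.finite_length_eq (Fin 2) n).subset ?_
  rintro u ⟨i, rfl⟩
  exact length_block w i n

theorem maxCount_isGreatest (a : Fin 2) (w : InfWord) (n : ℕ) :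
    IsGreatest {k | ∃ u ∈ factors w n, k = u.count a} (maxCount a w n) := by
  have hb : BddAbove {k | ∃ u ∈ factors w n, k = u.count a} := by
    refine ⟨n, ?_⟩
    rintro k ⟨u, ⟨i, rfl⟩, rfl⟩
    exact List.count_le_length.trans (length_block w i n).le
  refine ⟨Nat.sSup_mem ?_ hb, fun k hk => le_csSup hb hk⟩
  exact ⟨_, block w 0 n, ⟨0, rfl⟩, rfl⟩

theorem maxCount_le_succ (a : Fin 2) (w : InfWord) (n : ℕ) : maxCount a w n ≤ maxCount a w (n + 1) := by
  obtain ⟨u, ⟨i, rfl⟩, h⟩ := (maxCount_isGreatest a w n).1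
  have h2 := (maxCount_isGreatest a w (n + 1)).2 ⟨block w i (n + 1), ⟨i, rfl⟩, rfl⟩
  rw [block_succ, List.count_append] at h2
  omega

theorem maxCount_succ_le (a : Fin 2) (w : InfWord) (n : ℕ) : maxCount a w (n + 1) ≤ maxCount a w n + 1 := by
  obtain ⟨u, ⟨i, rfl⟩, h⟩ := (maxCount_isGreatest a w (n + 1)).1
  have h2 := (maxCount_isGreatest a w n).2 ⟨block w i n, ⟨i, rfl⟩, rfl⟩
  have h3 : List.count a [w (i + n)] ≤ 1 := List.count_le_length
  rw [block_succ, List.count_append] at h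
  omega

/-- The letter `maxCount a w (n + 1) - maxCount a w n`; this first difference is `0` or `1`. -/
noncomputable def diffMaxCount (a : Fin 2) (w : InfWord) (n : ℕ) : Fin 2 :=
  ⟨maxCount a w (n + 1) - maxCount a w n, by have := maxCount_succ_le a w n; omega⟩

/-- The prefix normal form of `w` with respect to `1`. -/
noncomputable def PNF₁ (w : InfWord) : InfWord := fun n => diffMaxCount 1 w n

/-- The prefix normal form of `w` with respect to `0`, the complement `1 - x` of the
first differences of `maxCount 0 w`. -/
noncomputable def PNF₀ (w : InfWord) : InfWord := fun n => 1 - diffMaxCount 0 w n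

theorem append_lt_append {u v : List (Fin 2)} (hl : u.length = v.length) (h : u < v)
    (x y : List (Fin 2)) : u ++ x < v ++ y := by
  induction u generalizing v with
  | nil =>
    cases v with
    | nil => exact absurd h (lt_irrefl _)
    | cons b v => simp at hl
  | cons a u ih =>
    cases v with
    | nil => simp at hl
    | cons b v =>
      simp only [List.length_cons, Nat.add_right_cancel_iff] at hl
      simp only [List.cons_append, List.cons_lt_cons_iff] at h ⊢
      rcases h with h | ⟨h1, h2⟩
      · exact Or.inl h
      · exact Or.inr ⟨h1, ih hl h2⟩

/-- Two sequences of blocks: if every `g n` is a factor of length `n` and each is the beginning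
of the next one, they are the prefixes of one infinite word. -/
theorem exists_word_of_chain (w : InfWord) (g : ℕ → ℕ)
    (h : ∀ n, block w (g (n + 1)) n = block w (g n) n) :
    ∃ m : InfWord, ∀ n, pref m n = block w (g n) n := by
  refine ⟨fun n => w (g (n + 1) + n), fun n => ?_⟩
  induction n with
  | zero => simp [pref, block]
  | succ n ih =>
    rw [pref, block_succ, block_succ, h n, ← ih, pref, Nat.zero_add]

theorem exists_max (w : InfWord) :
    ∃ m : InfWord, ∀ n, IsGreatest (factors w n) (pref m n) := by
  have H : ∀ n, ∃ i, IsGreatest (factors w n) (block w i n) := by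
    intro n
    obtain ⟨u, hu⟩ := (factors_finite w n).exists_maximal (factors_nonempty w n)
    obtain ⟨i, rfl⟩ := hu.1
    exact ⟨i, hu.1, fun v hv => (le_total v (block w i n)).elim id fun h => hu.2 hv h⟩
  choose g hg using H
  obtain ⟨m, hm⟩ := exists_word_of_chain w g (fun n => by
    refine le_antisymm ((hg n).2 ⟨_, rfl⟩) (not_lt.1 fun hlt => ?_)
    have h1 := append_lt_append (by simp [length_block]) hlt
      [w (g (n + 1) + n)] [w (g n + n)]
    rw [← block_succ, ← block_succ] at h1
    exact absurd h1 (not_lt.2 ((hg (n + 1)).2 ⟨_, rfl⟩)))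
  exact ⟨m, fun n => hm n ▸ hg n⟩

theorem exists_min (w : InfWord) :
    ∃ m : InfWord, ∀ n, IsLeast (factors w n) (pref m n) := by
  have H : ∀ n, ∃ i, IsLeast (factors w n) (block w i n) := by
    intro n
    obtain ⟨u, hu⟩ := (factors_finite w n).exists_minimal (factors_nonempty w n)
    obtain ⟨i, rfl⟩ := hu.1
    exact ⟨i, hu.1, fun v hv => (le_total (block w i n) v).elim id fun h => hu.2 hv h⟩
  choose g hg using H
  obtain ⟨m, hm⟩ := exists_word_of_chain w g (fun n => by
    refine le_antisymm (not_lt.1 fun hlt => ?_) ((hg n).2 ⟨_, rfl⟩)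
    have h1 := append_lt_append (by simp [length_block]) hlt
      [w (g n + n)] [w (g (n + 1) + n)]
    rw [← block_succ, ← block_succ] at h1
    exact absurd h1 (not_lt.2 ((hg (n + 1)).2 ⟨_, rfl⟩)))
  exact ⟨m, fun n => hm n ▸ hg n⟩

/-- `max(w)`: the (unique) infinite word whose prefix of each length `n` is the lexicographically
greatest factor of length `n` of `w`. The order
on lists is the lexicographic one. -/
noncomputable def maxWord (w : InfWord) : InfWord := Classical.choose (exists_max w)

/-- `min(w)`: the (unique) infinite word whose prefix of each length `n` is the lexicographically
smallest factor of length `n` of `w`. -/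
noncomputable def minWord (w : InfWord) : InfWord := Classical.choose (exists_min w)

theorem maxWord_spec (w : InfWord) (n : ℕ) : IsGreatest (factors w n) (pref (maxWord w) n) :=
  Classical.choose_spec (exists_max w) n

theorem minWord_spec (w : InfWord) (n : ℕ) : IsLeast (factors w n) (pref (minWord w) n) :=
  Classical.choose_spec (exists_min w) n

theorem eq_of_pref_eq {m m' : InfWord} (h : ∀ n, pref m n = pref m' n) : m = m' := by
  funext n
  have := h (n + 1)
  rw [pref, pref, block_succ, block_succ] at this
  simpa using (List.append_inj' this rfl).2

theorem eq_maxWord_iff (w m : InfWord) :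
    m = maxWord w ↔ ∀ n, IsGreatest (factors w n) (pref m n) :=
  ⟨fun h => h ▸ maxWord_spec w,
    fun h => eq_of_pref_eq fun n => (h n).unique (maxWord_spec w n)⟩

theorem eq_minWord_iff (w m : InfWord) :
    m = minWord w ↔ ∀ n, IsLeast (factors w n) (pref m n) :=
  ⟨fun h => h ▸ minWord_spec w,
    fun h => eq_of_pref_eq fun n => (h n).unique (minWord_spec w n)⟩

/-- The lower mechanical word of slope `α` and intercept `τ`, as an integer sequence; the
value at `n` is the letter in position `n + 1` counted from `1`. -/
noncomputable def lowerMechanical (α τ : ℝ) (n : ℕ) : ℤ :=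
  ⌊α * (n + 1) + τ⌋ - ⌊α * n + τ⌋

/-- The upper mechanical word of slope `α` and intercept `τ`, as an integer sequence. -/
noncomputable def upperMechanical (α τ : ℝ) (n : ℕ) : ℤ :=
  ⌈α * (n + 1) + τ⌉ - ⌈α * n + τ⌉

/-- `w` is the characteristic word of slope `α`: the lower and the upper mechanical words of
slope `α` and intercept `0` are `0w` and `1w`. -/
def IsCharacteristicWord (α : ℝ) (w : InfWord) : Prop :=
  (∀ n, lowerMechanical α 0 n = ((cons 0 w n : ℕ) : ℤ)) ∧
  (∀ n, upperMechanical α 0 n = ((cons 1 w n : ℕ) : ℤ))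

/-- For irrational `α` between `0` and `1` the characteristic word of slope `α` exists and
is unique. -/
theorem existsUnique_isCharacteristicWord {α : ℝ} (h0 : 0 ≤ α) (h1 : α ≤ 1)
    (hα : Irrational α) : ∃! w, IsCharacteristicWord α w := by
  have h0' : 0 < α := lt_of_le_of_ne h0 hα.ne_zero.symm
  have h1' : α < 1 := lt_of_le_of_ne h1 hα.ne_one
  have hceil : ∀ n : ℕ, ⌈α * ((n : ℝ) + 1)⌉ = ⌊α * ((n : ℝ) + 1)⌋ + 1 := by
    intro n
    have hir : Irrational (α * ((n + 1 : ℕ) : ℝ)) := hα.mul_natCast n.succ_ne_zero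
    push_cast at hir
    rw [Int.ceil_eq_iff]
    push_cast
    have hne : (⌊α * ((n : ℝ) + 1)⌋ : ℝ) ≠ α * ((n : ℝ) + 1) := fun h => hir.ne_int _ h.symm
    have := lt_of_le_of_ne (Int.floor_le (α * ((n : ℝ) + 1))) hne
    have := Int.lt_floor_add_one (α * ((n : ℝ) + 1))
    constructor <;> linarith
  have hd : ∀ x : ℝ, 0 ≤ ⌊x + α⌋ - ⌊x⌋ ∧ ⌊x + α⌋ - ⌊x⌋ < 2 := by
    intro x
    have a1 : ⌊x⌋ ≤ ⌊x + α⌋ := Int.floor_le_floor (by linarith)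
    have a2 : ⌊x + α⌋ ≤ ⌊x + 1⌋ := Int.floor_le_floor (by linarith)
    rw [Int.floor_add_one] at a2
    omega
  have hf : ⌊α⌋ = 0 := Int.floor_eq_zero_iff.2 ⟨h0, h1'⟩
  refine ⟨fun n => ⟨(⌊α * ((n : ℝ) + 1) + α⌋ - ⌊α * ((n : ℝ) + 1)⌋).toNat, ?_⟩,
    ⟨fun n => ?_, fun n => ?_⟩, fun v hv => ?_⟩
  · have := hd (α * ((n : ℝ) + 1))
    omega
  · cases n with
    | zero => simp [lowerMechanical, cons, hf]
    | succ n =>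
      have := hd (α * ((n : ℝ) + 1))
      have e : α * ((n : ℝ) + 1 + 1) = α * ((n : ℝ) + 1) + α := by ring
      simp only [lowerMechanical, cons, add_zero]
      push_cast
      rw [e]
      omega
  · cases n with
    | zero =>
      have := hceil 0
      simp only [Nat.cast_zero, zero_add, mul_one, hf] at this
      simp [upperMechanical, cons, this]
    | succ n =>
      have := hd (α * ((n : ℝ) + 1))
      have e : α * ((n : ℝ) + 1 + 1) = α * ((n : ℝ) + 1) + α := by ring
      have c1 := hceil n
      have c2 := hceil (n + 1)
      simp only [upperMechanical, cons, add_zero]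
      push_cast at c2 ⊢
      rw [c1, c2, e]
      omega
  · funext n
    have := hd (α * ((n : ℝ) + 1))
    have e : α * ((n : ℝ) + 1 + 1) = α * ((n : ℝ) + 1) + α := by ring
    have h := hv.1 (n + 1)
    simp only [lowerMechanical, cons, add_zero] at h
    push_cast at h
    rw [e] at h
    apply Fin.ext
    simp only
    omega

/-- `w` is characteristic Sturmian: it is the characteristic word of some irrational slope. -/
def IsCharacteristicSturmian (w : InfWord) : Prop :=
  ∃ α : ℝ, 0 ≤ α ∧ α ≤ 1 ∧ Irrational α ∧ IsCharacteristicWord α w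

end BinaryWord

/-! ### Counting ones in prefixes and blocks. -/

namespace BinaryWord

/-! Let `m n` be the number of ones in the prefix of length `n` of `0w`. A block of length `n` of
`w` has `m (i + 1 + n) - m (i + 1)` ones, and for `n > 0` the prefix of `1w` has `m n + 1`. So `0w`
and `1w` are the prefix normal forms exactly when the defect `m (i + 1 + n) - m (i + 1) - m n` is
always `0` or `1` for `n > 0`, with both values attained for each such `n`.

By a Fekete-type argument (`exists_irrational_eq_floor`), such an `m` is `n ↦ ⌊α n⌋` with `α`
irrational, so the two equalities with prefix normal forms already force `w` to be characteristic
Sturmian. Conversely, floors have defect `0` or `1`, and a multiple of `α` just above (below) an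
integer gives defect `0` (`1`) for all positive lengths up to `n` at once. Thus prefixes of `0w` and
`1w` are factors of `w` with extremal counts at every length, hence extremal lexicographically
(`block_le_block`). -/

theorem count_pref_add_count_block (a : Fin 2) (w : InfWord) (i n : ℕ) :
    (pref w i).count a + (block w i n).count a = (pref w (i + n)).count a := by
  induction n with
  | zero => simp [block]
  | succ n ih =>
    rw [block_succ, List.count_append, ← add_assoc, ih, pref, pref, ← add_assoc, block_succ,
      List.count_append, Nat.zero_add]

theorem count_zero_add_count_one (l : List (Fin 2)) : l.count 0 + l.count 1 = l.length := by
  induction l with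
  | nil => rfl
  | cons a l ih =>
    rw [List.count_cons, List.count_cons, List.length_cons]
    fin_cases a <;> simp <;> omega

theorem count_one_pref_succ (w : InfWord) (n : ℕ) :
    (pref w (n + 1)).count 1 = (pref w n).count 1 + (w n : ℕ) := by
  rw [pref, block_succ, List.count_append, Nat.zero_add, pref]
  generalize w n = a
  fin_cases a <;> simp

theorem count_one_pref_cons (a : Fin 2) (w : InfWord) (n : ℕ) :
    (pref (cons a w) (n + 1)).count 1 = (pref w n).count 1 + (a : ℕ) := by
  induction n with
  | zero => rw [count_one_pref_succ]; simp [pref, block, cons]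
  | succ n ih => rw [count_one_pref_succ, ih, count_one_pref_succ w]; simp only [cons]; omega

/-- Position `i` of `w` is position `i + 1` of `0w`; hence the shift in all later additivity
statements. -/
theorem count_one_block (w : InfWord) (i n : ℕ) :
    (pref (cons 0 w) (i + 1)).count 1 + (block w i n).count 1 =
      (pref (cons 0 w) (i + 1 + n)).count 1 := by
  rw [Nat.add_right_comm, count_one_pref_cons, count_one_pref_cons, ← count_pref_add_count_block]
  simp

/-- Comparing the numbers of ones in all prefixes of two blocks compares the blocks. -/
theorem block_le_block {v w : InfWord} {i j n : ℕ}
    (h : ∀ k ≤ n, (block v i k).count 1 ≤ (block w j k).count 1) :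
    block v i n ≤ block w j n := by
  induction n with
  | zero => simp [block]
  | succ n ih =>
    -- Either the order is settled before the last letter, or the shorter blocks agree and the count
    -- at `n + 1` compares the last letters.
    rcases (ih fun k hk => h k (by omega)).lt_or_eq with hlt | heq
    · rw [block_succ, block_succ]
      exact (append_lt_append (by simp [length_block]) hlt _ _).le
    · have h1 := h (n + 1) le_rfl
      rw [block_succ, block_succ, heq, List.count_append, List.count_append] at h1
      rw [block_succ, block_succ, heq]
      generalize v (i + n) = a at *
      generalize w (j + n) = b at *
      fin_cases a <;> fin_cases b <;> simp at h1 ⊢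
      exact (List.append_left_lt (by decide)).le

/-! ### Prefix normal forms in terms of counts. -/

theorem maxCount_zero (a : Fin 2) (w : InfWord) : maxCount a w 0 = 0 := by
  obtain ⟨u, ⟨i, rfl⟩, h⟩ := (maxCount_isGreatest a w 0).1
  simpa [block] using h

/-- The letters are first differences of `maxCount`, so summing them telescopes, starting from
`maxCount_zero`. -/
theorem eq_PNF₁_iff (v w : InfWord) :
    v = PNF₁ w ↔ ∀ n, maxCount 1 w n = (pref v n).count 1 := by
  constructor
  · rintro rfl n
    induction n with
    | zero => simp [maxCount_zero, pref, block]
    | succ n ih =>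
      have := maxCount_le_succ 1 w n
      rw [count_one_pref_succ, ← ih]
      simp only [PNF₁, diffMaxCount]
      omega
  · intro h
    funext n
    have := count_one_pref_succ v n
    rw [← h, ← h] at this
    apply Fin.ext
    simp only [PNF₁, diffMaxCount]
    omega

theorem eq_PNF₀_iff (v w : InfWord) :
    v = PNF₀ w ↔ ∀ n, maxCount 0 w n = (pref v n).count 0 := by
  have key (n : ℕ) : (pref v n).count 0 + (pref v n).count 1 = n := by
    rw [count_zero_add_count_one, pref, length_block]
  -- Subtraction in `Fin 2` is modular; this form over the naturals is accessible to `omega`.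
  have compl (a b : Fin 2) : a = 1 - b ↔ (a : ℕ) + b = 1 := by decide +revert
  have hstep : v = PNF₀ w ↔ ∀ n, (v n : ℕ) + (maxCount 0 w (n + 1) - maxCount 0 w n) = 1 := by
    rw [funext_iff]
    exact forall_congr' fun n => compl _ _
  rw [hstep]
  constructor
  · intro h n
    induction n with
    | zero => simp [maxCount_zero, pref, block]
    | succ n ih =>
      have := maxCount_le_succ 0 w n
      have := count_one_pref_succ v n
      have := h n
      have := key n
      have := key (n + 1)
      omega
  · intro h n
    have := count_one_pref_succ v n
    have := key n
    have := key (n + 1)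
    have := (v n).2
    rw [h, h]
    omega

end BinaryWord

/-! ### Almost additive integer sequences. -/

/-- An integer sequence whose defects from additivity all are `0` or `1`, both values being
attained for every increment, consists of the floors of the multiples of an irrational number. -/
theorem exists_irrational_eq_floor {m : ℕ → ℤ} (h0 : m 0 = 0)
    (hl : ∀ i n, m (i + 1) + m n ≤ m (i + 1 + n))
    (hu : ∀ i n, m (i + 1 + n) ≤ m (i + 1) + m n + 1)
    (el : ∀ n, ∃ i, m (i + 1 + n) = m (i + 1) + m n)
    (eu : ∀ n, 0 < n → ∃ i, m (i + 1 + n) = m (i + 1) + m n + 1) :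
    ∃ α : ℝ, Irrational α ∧ ∀ n : ℕ, ⌊α * n⌋ = m n := by
  -- `m` is superadditive and `m + 1` is subadditive; iterating both and comparing at `a * b` bounds
  -- every `m a / a` by every `(m b + 1) / b`.
  have sup (a b : ℕ) (ha : 0 < a) : b * m a ≤ m (a * b) := by
    obtain ⟨a, rfl⟩ := Nat.exists_eq_succ_of_ne_zero ha.ne'
    induction b with
    | zero => simp [h0]
    | succ b ih =>
      have := hl a ((a + 1) * b)
      rw [show (a.succ) * (b + 1) = a + 1 + (a + 1) * b by simp; ring]
      push_cast
      simp only [Nat.succ_eq_add_one] at *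
      linarith
  have sub (a b : ℕ) (ha : 0 < a) (hb : 0 < b) : m (a * b) + 1 ≤ b * (m a + 1) := by
    obtain ⟨a, rfl⟩ := Nat.exists_eq_succ_of_ne_zero ha.ne'
    induction b, hb using Nat.le_induction with
    | base => simp
    | succ b hb ih =>
      have := hu a ((a + 1) * b)
      rw [show (a.succ) * (b + 1) = a + 1 + (a + 1) * b by simp; ring]
      push_cast
      simp only [Nat.succ_eq_add_one] at *
      linarith
  have cross (a b : ℕ) (ha : 0 < a) (hb : 0 < b) :
      (m a : ℝ) / a ≤ (m b + 1) / b := by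
    have h1 := sup a b ha
    have h2 := sub b a hb ha
    rw [mul_comm b a] at h2
    rw [div_le_div_iff₀ (by positivity) (by positivity)]
    have : m a * b ≤ (m b + 1) * a := by linarith
    exact_mod_cast this
  obtain ⟨α, hα⟩ : ∃ α : ℝ, ∀ n : ℕ, 0 < n → (m n : ℝ) ≤ α * n ∧ α * n ≤ m n + 1 := by
    let T : Set ℝ := {x | ∃ n : ℕ, 0 < n ∧ x = m n / n}
    have hb (b : ℕ) (hb : 0 < b) : (m b + 1 : ℝ) / b ∈ upperBounds T := by
      rintro x ⟨a, ha, rfl⟩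
      exact cross a b ha hb
    refine ⟨sSup T, fun n hn => ⟨?_, ?_⟩⟩
    · rw [← div_le_iff₀ (by positivity)]
      exact le_csSup ⟨_, hb 1 one_pos⟩ ⟨n, hn, rfl⟩
    · rw [← le_div_iff₀ (by positivity)]
      exact csSup_le ⟨_, 1, one_pos, rfl⟩ (hb n hn)
  -- The comparison at `a * b` has a spare `1`, so the lower and the upper bound on `α` cannot both
  -- be attained.
  have excl (a b : ℕ) (ha : 0 < a) (hb : 0 < b) (h1 : (m a : ℝ) = α * a)
      (h2 : α * b = m b + 1) : False := by
    have h3 := sup a b ha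
    have h4 := sub b a hb ha
    rw [mul_comm b a] at h4
    have h5 : (b * m a : ℝ) + 1 ≤ a * (m b + 1) := by exact_mod_cast (by linarith)
    rw [h1, ← h2] at h5
    linarith
  -- If the lower bound is attained at `n`, an increment with defect `1` makes the upper bound
  -- attained at `i + 1`, against `excl`. The proof of `hgt` is symmetric, with defect `0`.
  have hlt (n : ℕ) (hn : 0 < n) : (m n : ℝ) < α * n := by
    refine (hα n hn).1.lt_of_ne fun h => ?_
    obtain ⟨i, hi⟩ := eu n hn
    have hi' : (m (i + 1 + n) : ℝ) = m (i + 1) + m n + 1 := by exact_mod_cast hi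
    have h1 := (hα (i + 1) i.succ_pos).2
    have h2 := (hα (i + 1 + n) (by omega)).1
    refine excl n (i + 1) hn i.succ_pos h (le_antisymm h1 ?_)
    push_cast at *
    linarith
  have hgt (n : ℕ) (hn : 0 < n) : α * n < m n + 1 := by
    refine (hα n hn).2.lt_of_ne fun h => ?_
    obtain ⟨i, hi⟩ := el n
    have hi' : (m (i + 1 + n) : ℝ) = m (i + 1) + m n := by exact_mod_cast hi
    have h1 := (hα (i + 1) i.succ_pos).1
    have h2 := (hα (i + 1 + n) (by omega)).2
    refine excl (i + 1) n i.succ_pos hn (le_antisymm h1 ?_) h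
    push_cast at *
    linarith
  refine ⟨α, ?_, fun n => ?_⟩
  -- At `n = q.den` the product would be an integer strictly between consecutive integers.
  · rintro ⟨q, rfl⟩
    have h1 := hlt q.den q.pos
    have h2 := hgt q.den q.pos
    have h3 : (q : ℝ) * q.den = q.num := by exact_mod_cast q.mul_den_eq_num
    rw [h3] at h1 h2
    have h4 : m q.den < q.num := by exact_mod_cast h1
    have h5 : q.num < m q.den + 1 := by exact_mod_cast h2
    omega
  · rcases n.eq_zero_or_pos with rfl | hn
    · simp [h0]
    · exact Int.floor_eq_iff.2 ⟨(hlt n hn).le, hgt n hn⟩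

/-! ### Multiples of an irrational number close to an integer. -/

/-- Some positive multiple of an irrational number lies just above an integer. -/
theorem Irrational.exists_nat_mul_sub_int_lt {α : ℝ} (hα : Irrational α) {ε : ℝ} (hε : 0 < ε) :
    ∃ (i : ℕ) (p : ℤ), 0 < α * (i + 1 : ℕ) - p ∧ α * (i + 1 : ℕ) - p < ε := by
  have hne (q : ℕ) (hq : 0 < q) (p : ℤ) : α * q ≠ p := (hα.mul_natCast hq.ne').ne_int p
  obtain ⟨N, hN⟩ := exists_nat_one_div_lt hε
  -- Dirichlet approximation does not control the side on which `α * q` lies.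
  obtain ⟨q, hq, -, h⟩ := Real.exists_nat_abs_mul_sub_round_le α N.succ_pos
  set r := round (q * α)
  have hN' : (1 : ℝ) / ((N.succ : ℕ) + 1) ≤ 1 / (N + 1) := by
    apply one_div_le_one_div_of_le (by positivity); push_cast; linarith
  have hd : |α * q - r| < ε := by rw [mul_comm α]; linarith
  rcases lt_or_gt_of_ne (hne q hq r) with hlt | hgt
  · set d := r - α * q with hd'
    have hd0 : 0 < d := by linarith
    have hdε : d < ε := by rw [abs_of_neg (by linarith)] at hd; linarith
    have hd1 : d ≤ 1 := by
      rw [abs_of_neg (by linarith)] at hd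
      have : (1 : ℝ) / ((N.succ : ℕ) + 1) ≤ 1 := by
        rw [div_le_one (by positivity)]; push_cast; linarith [N.cast_nonneg (α := ℝ)]
      rw [mul_comm, abs_of_neg (by linarith)] at h
      linarith
    -- When `α * q` is `d` below `r`, take as many copies of this deficit as fit into `1`: then `α *
    -- (k * q)` exceeds `k * r - 1` by `1 - k * d`, which is less than `d` and nonzero by
    -- irrationality.
    set k := ⌊1 / d⌋₊
    have hk0 : 0 < k := Nat.floor_pos.2 (by rwa [le_div_iff₀ hd0, one_mul])
    have hk1 : k * d ≤ 1 := (le_div_iff₀ hd0).1 (Nat.floor_le (by positivity))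
    have hk2 : 1 < (k + 1) * d := (div_lt_iff₀ hd0).1 (Nat.lt_floor_add_one _)
    have hkq : 0 < k * q := Nat.mul_pos hk0 hq
    have hne' := hne (k * q) hkq (k * r - 1)
    have hkd : α * (k * q : ℕ) - (k * r - 1 : ℤ) = 1 - k * d := by push_cast; rw [hd']; ring
    refine ⟨k * q - 1, k * r - 1, ?_⟩
    rw [Nat.sub_add_cancel hkq]
    refine ⟨lt_of_le_of_ne ?_ (sub_ne_zero.2 hne').symm, ?_⟩ <;> linarith
  · refine ⟨q - 1, r, ?_⟩
    rw [Nat.sub_add_cancel hq]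
    rw [abs_of_pos (by linarith)] at hd
    exact ⟨by linarith, hd⟩

theorem exists_pos_forall_le {f : ℕ → ℝ} {n : ℕ} (h : ∀ k ≤ n, 0 < f k) :
    ∃ ε > 0, ∀ k ≤ n, ε ≤ f k := by
  obtain ⟨j, hj, hmin⟩ := (Finset.range (n + 1)).exists_min_image f ⟨0, by simp⟩
  simp only [Finset.mem_range, Nat.lt_succ_iff] at hj hmin
  exact ⟨f j, h j hj, hmin⟩

/-- Take `α * (i + 1)` above an integer by less than the distance from each `α * k`, `k ≤ n`, up to
the next integer; adding it then carries no `α * k` past that integer. -/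
theorem Irrational.exists_floor_add_eq {α : ℝ} (hα : Irrational α) (n : ℕ) :
    ∃ i : ℕ, ∀ k ≤ n, ⌊α * (i + 1 + k : ℕ)⌋ = ⌊α * (i + 1 : ℕ)⌋ + ⌊α * k⌋ := by
  obtain ⟨ε, hε, h⟩ := exists_pos_forall_le (n := n) (f := fun k => ⌊α * k⌋ + 1 - α * k)
    fun k _ => sub_pos.2 (Int.lt_floor_add_one _)
  obtain ⟨i, p, h1, h2⟩ := hα.exists_nat_mul_sub_int_lt hε
  have key (k : ℕ) (hk : k ≤ n) : ⌊α * (i + 1 + k : ℕ)⌋ = p + ⌊α * k⌋ := by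
    have h3 := h k hk
    have h4 := Int.floor_le (α * k)
    rw [Int.floor_eq_iff]
    push_cast at *
    constructor <;> linarith
  refine ⟨i, fun k hk => ?_⟩
  have := key 0 n.zero_le
  simp only [add_zero, Nat.cast_zero, mul_zero, Int.floor_zero] at this
  rw [key k hk, this]

/-- Take `α * (i + 1)` below an integer by less than the fractional part of each `α * k`, `0 < k ≤
n`, by approximating with `-α`; each of these fractional parts then produces a carry. -/
theorem Irrational.exists_floor_add_eq_add_one {α : ℝ} (hα : Irrational α) (n : ℕ) :
    ∃ i : ℕ, ∀ k < n, ⌊α * (i + 1 + (k + 1) : ℕ)⌋ = ⌊α * (i + 1 : ℕ)⌋ + ⌊α * (k + 1 : ℕ)⌋ + 1 := by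
  obtain ⟨ε, hε, h⟩ := exists_pos_forall_le (n := n)
    -- The fractional part vanishes at `k = 0`; the value `1` there instead gives `ε ≤ 1`, which
    -- fixes the floor of `α * (i + 1)`.
    (f := fun k => if k = 0 then 1 else α * k - ⌊α * k⌋) fun k _ => by
      split_ifs with hk
      · exact one_pos
      · exact sub_pos.2 (lt_of_le_of_ne (Int.floor_le _)
          ((hα.mul_natCast hk).ne_int _).symm)
  obtain ⟨i, p, h1, h2⟩ := hα.neg.exists_nat_mul_sub_int_lt hε
  have h0 : ε ≤ 1 := by simpa using h 0 n.zero_le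
  have h5 : ⌊α * (i + 1 : ℕ)⌋ = -p - 1 := by
    rw [Int.floor_eq_iff]
    push_cast at *
    constructor <;> linarith
  refine ⟨i, fun k hk => ?_⟩
  have h3 := h (k + 1) hk
  have h4 := Int.lt_floor_add_one (α * (k + 1 : ℕ))
  rw [if_neg k.succ_ne_zero] at h3
  rw [h5, Int.floor_eq_iff]
  push_cast at *
  constructor <;> linarith

/-! ### Characteristic words and prefix normal forms through counts of ones. -/

namespace BinaryWord

theorem eq_of_count_one_pref_eq {v w : InfWord}
    (h : ∀ n, (pref v n).count 1 = (pref w n).count 1) : v = w :=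
  eq_of_pref_eq fun _ => le_antisymm (block_le_block fun k _ => (h k).le)
    (block_le_block fun k _ => (h k).ge)

theorem IsCharacteristicWord.floor_eq {α : ℝ} {w : InfWord} (h : IsCharacteristicWord α w)
    (n : ℕ) : ⌊α * n⌋ = ((pref (cons 0 w) n).count 1 : ℤ) := by
  induction n with
  | zero => simp [pref, block]
  | succ n ih =>
    have := h.1 n
    simp only [lowerMechanical, add_zero] at this
    rw [count_one_pref_succ]
    push_cast
    linarith

/-- The floors determine `0w`, so `w` coincides with the characteristic word of slope `α`, which is
known to exist; this also supplies the upper mechanical condition. -/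
theorem isCharacteristicWord_of_floor_eq {α : ℝ} {w : InfWord} (hα : Irrational α)
    (h : ∀ n : ℕ, ⌊α * n⌋ = ((pref (cons 0 w) n).count 1 : ℤ)) :
    0 ≤ α ∧ α ≤ 1 ∧ IsCharacteristicWord α w := by
  have h1 : ⌊α⌋ = 0 := by
    have := h 1
    rwa [count_one_pref_cons, Nat.cast_one, mul_one] at this
  obtain ⟨h2, h3⟩ := Int.floor_eq_zero_iff.1 h1
  refine ⟨h2, h3.le, ?_⟩
  obtain ⟨v, hv, -⟩ := existsUnique_isCharacteristicWord h2 h3.le hα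
  have hvw : cons 0 v = cons 0 w := eq_of_count_one_pref_eq fun n => by
    have := hv.floor_eq n
    rw [h n] at this
    exact_mod_cast this.symm
  rwa [show w = v from funext fun n => (congrFun hvw (n + 1)).symm]

theorem count_zero_block (w : InfWord) (i n : ℕ) :
    (block w i n).count 0 + (block w i n).count 1 = n := by
  rw [count_zero_add_count_one, length_block]

theorem maxCount_eq_iff {a : Fin 2} {w : InfWord} {n k : ℕ} :
    maxCount a w n = k ↔
      (∃ i, (block w i n).count a = k) ∧ ∀ i, (block w i n).count a ≤ k := by
  have hg := maxCount_isGreatest a w n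
  constructor
  · rintro rfl
    obtain ⟨_, ⟨i, rfl⟩, hi⟩ := hg.1
    exact ⟨⟨i, hi.symm⟩, fun j => hg.2 ⟨_, ⟨j, rfl⟩, rfl⟩⟩
  · rintro ⟨⟨i, hi⟩, h⟩
    refine hg.unique ⟨⟨_, ⟨i, rfl⟩, hi.symm⟩, ?_⟩
    rintro _ ⟨_, ⟨j, rfl⟩, rfl⟩
    exact h j

/-- In terms of the numbers `m n` of ones in the prefixes of `0w`, the word `0w` is the prefix
normal form for `0` if and only if `m n` is the least number of ones in a factor. -/
theorem cons_zero_eq_PNF₀_iff (w : InfWord) :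
    cons 0 w = PNF₀ w ↔ ∀ n,
      (∃ i, (block w i n).count 1 = (pref (cons 0 w) n).count 1) ∧
      ∀ i, (pref (cons 0 w) n).count 1 ≤ (block w i n).count 1 := by
  rw [eq_PNF₀_iff]
  refine forall_congr' fun n => ?_
  rw [maxCount_eq_iff]
  have h (i : ℕ) := count_zero_block w i n
  have h' := count_zero_block (cons 0 w) 0 n
  rw [pref]
  refine and_congr (exists_congr fun i => ?_) (forall_congr' fun i => ?_) <;>
  · have := h i
    omega

theorem cons_one_eq_PNF₁_iff (w : InfWord) :
    cons 1 w = PNF₁ w ↔ ∀ n,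
      (∃ i, (block w i n).count 1 = (pref (cons 1 w) n).count 1) ∧
      ∀ i, (block w i n).count 1 ≤ (pref (cons 1 w) n).count 1 := by
  rw [eq_PNF₁_iff]
  exact forall_congr' fun n => maxCount_eq_iff

theorem count_one_pref_cons_one (w : InfWord) (n : ℕ) :
    (pref (cons 1 w) (n + 1)).count 1 = (pref (cons 0 w) (n + 1)).count 1 + 1 := by
  rw [count_one_pref_cons, count_one_pref_cons]
  simp

/-! ### From prefix normal forms to an irrational slope. -/

theorem isCharacteristicSturmian_of_eq_PNF {w : InfWord} (h0 : cons 0 w = PNF₀ w)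
    (h1 : cons 1 w = PNF₁ w) : IsCharacteristicSturmian w := by
  rw [cons_zero_eq_PNF₀_iff] at h0
  rw [cons_one_eq_PNF₁_iff] at h1
  obtain ⟨α, hα, hm⟩ := exists_irrational_eq_floor
    (m := fun n => ((pref (cons 0 w) n).count 1 : ℤ)) (by simp [pref, block])
    (fun i n => by
      have := (h0 n).2 i
      have := count_one_block w i n
      omega)
    (fun i n => by
      have := (h1 n).2 i
      have := count_one_block w i n
      cases n with
      -- The empty prefix of `1w` lacks the extra one, so length `0` is separate.
      | zero => simp only [add_zero]; omega
      | succ n =>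
        have := count_one_pref_cons_one w n
        omega)
    (fun n => by
      obtain ⟨i, hi⟩ := (h0 n).1
      have := count_one_block w i n
      exact ⟨i, by omega⟩)
    (fun n hn => by
      obtain ⟨i, hi⟩ := (h1 n).1
      have := count_one_block w i n
      obtain ⟨n, rfl⟩ := Nat.exists_eq_succ_of_ne_zero hn.ne'
      have := count_one_pref_cons_one w n
      exact ⟨i, by simp only [Nat.succ_eq_add_one] at *; omega⟩)
  obtain ⟨ha, hb, hw⟩ := isCharacteristicWord_of_floor_eq hα hm
  exact ⟨α, ha, hb, hα, hw⟩

/-! ### From an irrational slope to extremal words. -/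

/-- Every prefix of `0w` is a factor of a characteristic Sturmian word `w`, and no factor has
fewer ones. -/
theorem IsCharacteristicWord.cons_zero {α : ℝ} {w : InfWord} (hα : Irrational α)
    (h : IsCharacteristicWord α w) (n : ℕ) :
    (∃ i, ∀ k ≤ n, (block w i k).count 1 = (pref (cons 0 w) k).count 1) ∧
      ∀ i, (pref (cons 0 w) n).count 1 ≤ (block w i n).count 1 := by
  constructor
  -- One `i` serves all `k ≤ n`, so the block equals the prefix of `0w` letter by letter; equal
  -- counts at `n` alone would not suffice for `minWord`.
  · obtain ⟨i, hi⟩ := hα.exists_floor_add_eq n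
    refine ⟨i, fun k hk => ?_⟩
    have h1 := hi k hk
    have := count_one_block w i k
    simp only [h.floor_eq] at h1
    omega
  · intro i
    have h1 := Int.le_floor_add (α * (i + 1 : ℕ)) (α * n)
    rw [← mul_add, ← Nat.cast_add] at h1
    have := count_one_block w i n
    simp only [h.floor_eq] at h1
    omega

/-- Every prefix of `1w` is a factor of a characteristic Sturmian word `w`, and no factor has
more ones. -/
theorem IsCharacteristicWord.cons_one {α : ℝ} {w : InfWord} (hα : Irrational α)
    (h : IsCharacteristicWord α w) (n : ℕ) :
    (∃ i, ∀ k ≤ n, (block w i k).count 1 = (pref (cons 1 w) k).count 1) ∧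
      ∀ i, (block w i n).count 1 ≤ (pref (cons 1 w) n).count 1 := by
  constructor
  · obtain ⟨i, hi⟩ := hα.exists_floor_add_eq_add_one n
    refine ⟨i, fun k hk => ?_⟩
    cases k with
    | zero => simp [pref, block]
    | succ k =>
      have h1 := hi k hk
      have := count_one_block w i (k + 1)
      have := count_one_pref_cons_one w k
      simp only [h.floor_eq] at h1
      omega
  · intro i
    cases n with
    | zero => simp [block]
    | succ n =>
      have h1 := Int.le_floor_add_floor (α * (i + 1 : ℕ)) (α * (n + 1 : ℕ))
      rw [← mul_add, ← Nat.cast_add] at h1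
      have := count_one_block w i (n + 1)
      have := count_one_pref_cons_one w n
      simp only [h.floor_eq] at h1
      omega

theorem IsCharacteristicWord.cons_zero_eq_minWord {α : ℝ} {w : InfWord} (hα : Irrational α)
    (h : IsCharacteristicWord α w) : cons 0 w = minWord w := by
  rw [eq_minWord_iff]
  refine fun n => ⟨?_, ?_⟩
  · obtain ⟨i, hi⟩ := (h.cons_zero hα n).1
    exact ⟨i, le_antisymm (block_le_block fun k hk => (hi k hk).ge)
      (block_le_block fun k hk => (hi k hk).le)⟩
  · rintro _ ⟨i, rfl⟩
    exact block_le_block fun k _ => (h.cons_zero hα k).2 i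

theorem IsCharacteristicWord.cons_one_eq_maxWord {α : ℝ} {w : InfWord} (hα : Irrational α)
    (h : IsCharacteristicWord α w) : cons 1 w = maxWord w := by
  rw [eq_maxWord_iff]
  refine fun n => ⟨?_, ?_⟩
  · obtain ⟨i, hi⟩ := (h.cons_one hα n).1
    exact ⟨i, le_antisymm (block_le_block fun k hk => (hi k hk).ge)
      (block_le_block fun k hk => (hi k hk).le)⟩
  · rintro _ ⟨i, rfl⟩
    exact block_le_block fun k _ => (h.cons_one hα k).2 i

end BinaryWord

theorem corollary4 (w : BinaryWord.InfWord) :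
    BinaryWord.IsCharacteristicSturmian w ↔
      (BinaryWord.cons 0 w = BinaryWord.PNF₀ w ∧ BinaryWord.PNF₀ w = BinaryWord.minWord w) ∧
      (BinaryWord.cons 1 w = BinaryWord.PNF₁ w ∧ BinaryWord.PNF₁ w = BinaryWord.maxWord w) := by
  constructor
  · rintro ⟨α, -, -, hα, h⟩
    have h0 : BinaryWord.cons 0 w = BinaryWord.PNF₀ w :=
      (BinaryWord.cons_zero_eq_PNF₀_iff w).2 fun n =>
        ⟨(h.cons_zero hα n).1.imp fun i hi => hi n le_rfl, (h.cons_zero hα n).2⟩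
    have h1 : BinaryWord.cons 1 w = BinaryWord.PNF₁ w :=
      (BinaryWord.cons_one_eq_PNF₁_iff w).2 fun n =>
        ⟨(h.cons_one hα n).1.imp fun i hi => hi n le_rfl, (h.cons_one hα n).2⟩
    exact ⟨⟨h0, h0.symm.trans (h.cons_zero_eq_minWord hα)⟩,
      h1, h1.symm.trans (h.cons_one_eq_maxWord hα)⟩
  · rintro ⟨⟨h0, -⟩, h1, -⟩
    exact BinaryWord.isCharacteristicSturmian_of_eq_PNF h0 h1
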